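/- Let $\Omega\subset\mathbb R^3$ be a bounded domain (non-empty, open and connected) whose boundary is of class $C^{1,\alpha}$ for some $0<\alpha\le 1$; that is, every $P_0\in\partial\Omega$ has a neighbourhood in which $\partial\Omega$ is the graph of a $C^{1,\alpha}$ function of two of the three coordinates, with $\Omega$ on one side of the graph and the complement of $\overline\Omega$ on the other. For $P\in\partial\Omega$ let $n_P$ be the exterior unit normal to $\partial\Omega$ at $P$, let $dS$ be the surface measure on $\partial\Omega$, and for $M\in\mathbb R^3$ write ${\bf r}_{MP}=\overrightarrow{MP}$ and $r_{MP}=|P-M|$. Then for every $M\in\mathbb R^3$ the function $P\mapsto |{\bf r}_{MP}\cdot n_P|/r_{MP}^3$ is integrable over $\partial\Omega$, and $$\sup_{M\in\mathbb R^3}\int_{\partial\Omega}\frac{|{\bf r}_{MP}\cdot n_P|}{r_{MP}^3}\,dS_P<\infty .$$ -/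

import Mathlib

open MeasureTheory Metric Set Filter Topology
open scoped NNReal RealInnerProductSpace

/-- Euclidean space `ℝ³`. -/
abbrev E3 : Type := EuclideanSpace ℝ (Fin 3)

/-- Euclidean plane `ℝ²`. -/
abbrev E2 : Type := EuclideanSpace ℝ (Fin 2)

/-- The projection `ℝ³ → ℝ²` that forgets the `i`-th coordinate. -/
def dropCoord (i : Fin 3) (P : E3) : E2 :=
  WithLp.toLp 2 fun j : Fin 2 => P (i.succAbove j)

/-- Near `P₀` the set `Ω` lies on one side of the graph of a `C^{1,α}` function `f` of two of the
three coordinates, and the graph is the boundary of `Ω`: in some ball around `P₀`,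
`Ω` is `{σ (P i - f) < 0}` and `∂Ω` is `{P i = f}`
(hence the complement of the closure is `{σ (P i - f) > 0}`). Here `σ = ± 1` tells on
which side `Ω` lies. The disc `ball (dropCoord i P₀) r` is the projection of the ball, and
`f` is continuously differentiable on it with an `α`-Hölder continuous derivative. -/
def IsC1HolderGraphAt (α : ℝ≥0) (Ω : Set E3) (P₀ : E3) : Prop :=
  ∃ r : ℝ, 0 < r ∧ ∃ (i : Fin 3) (σ : ℝ) (f : E2 → ℝ) (C : ℝ≥0),
    (σ = 1 ∨ σ = -1) ∧
    ContDiffOn ℝ 1 f (ball (dropCoord i P₀) r) ∧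
    HolderOnWith C α (fderiv ℝ f) (ball (dropCoord i P₀) r) ∧
    ∀ P ∈ ball P₀ r,
      (P ∈ Ω ↔ σ * (P i - f (dropCoord i P)) < 0) ∧
      (P ∈ frontier Ω ↔ P i = f (dropCoord i P))

/-- `∂Ω ∈ C^{1,α}`. -/
def HasC1HolderBoundary (α : ℝ≥0) (Ω : Set E3) : Prop :=
  ∀ P₀ ∈ frontier Ω, IsC1HolderGraphAt α Ω P₀

/-- `n` is the exterior unit normal to `∂Ω` at `P`: up to arbitrarily thin cones around the plane
through `P` orthogonal to `n`, near `P` the side to which `n` points is outside the closure of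
`Ω` and the opposite side is inside `Ω`. -/
def IsExteriorUnitNormal (Ω : Set E3) (P n : E3) : Prop :=
  ‖n‖ = 1 ∧ ∀ ε : ℝ, 0 < ε → ∀ᶠ Q in 𝓝 P,
    (ε * ‖Q - P‖ < ⟪Q - P, n⟫ → Q ∉ closure Ω) ∧
    (⟪Q - P, n⟫ < -(ε * ‖Q - P‖) → Q ∈ Ω)

open Classical in
/-- The exterior unit normal `n_P` to `∂Ω` at `P` (and `0` where there is none). -/
noncomputable def exteriorNormal (Ω : Set E3) (P : E3) : E3 :=
  if h : ∃ n, IsExteriorUnitNormal Ω P n then h.choose else 0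

/-- The integrand `|r_{MP} · n_P| / r_{MP}³` of the absolute solid angle. -/
noncomputable def solidAngleIntegrand (Ω : Set E3) (M P : E3) : ℝ :=
  |⟪P - M, exteriorNormal Ω P⟫| / ‖P - M‖ ^ 3

/-- The surface measure `dS` on `∂Ω`: two-dimensional Hausdorff measure, normalized so as to agree
with area on planes, restricted to `∂Ω`. -/
noncomputable def surfaceMeasure (Ω : Set E3) : Measure E3 :=
  (Measure.euclideanHausdorffMeasure 2).restrict (frontier Ω)

/-- There is at most one exterior unit normal at a point. -/
theorem IsExteriorUnitNormal.unique {Ω : Set E3} {P n₁ n₂ : E3}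
    (h₁ : IsExteriorUnitNormal Ω P n₁) (h₂ : IsExteriorUnitNormal Ω P n₂) : n₁ = n₂ := by
  by_contra hne
  have hv : 0 < ‖n₁ - n₂‖ := norm_pos_iff.2 (sub_ne_zero.2 hne)
  have e1 : ⟪n₁ - n₂, n₁⟫ = ‖n₁ - n₂‖ ^ 2 / 2 := by
    rw [norm_sub_sq_real, inner_sub_left, real_inner_self_eq_norm_sq, h₁.1, h₂.1,
      real_inner_comm]
    ring
  have e2 : ⟪n₁ - n₂, n₂⟫ = -(‖n₁ - n₂‖ ^ 2 / 2) := by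
    rw [norm_sub_sq_real, inner_sub_left, real_inner_self_eq_norm_sq, h₁.1, h₂.1]
    ring
  set v := n₁ - n₂
  have hε : 0 < ‖v‖ / 4 := by positivity
  have ht : Tendsto (fun t : ℝ => P + t • v) (𝓝[>] 0) (𝓝 P) := by
    have hc : Continuous fun t : ℝ => P + t • v := by fun_prop
    have := hc.tendsto 0
    simp only [zero_smul, add_zero] at this
    exact this.mono_left nhdsWithin_le_nhds
  obtain ⟨t, ⟨ha, hb⟩, ht0⟩ := ((ht.eventually ((h₁.2 _ hε).and (h₂.2 _ hε))).and
    self_mem_nhdsWithin).exists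
  have ht0 : 0 < t := ht0
  have hn : ‖P + t • v - P‖ = t * ‖v‖ := by
    rw [add_sub_cancel_left, norm_smul, Real.norm_of_nonneg ht0.le]
  have hp : 0 < t * ‖v‖ ^ 2 := by positivity
  refine ha.1 ?_ (subset_closure (hb.2 ?_))
  · rw [hn, add_sub_cancel_left, real_inner_smul_left, e1]; nlinarith
  · rw [hn, add_sub_cancel_left, real_inner_smul_left, e2]; nlinarith

/-- At every point of a `C^{1,α}` boundary the exterior unit normal exists. -/
theorem IsC1HolderGraphAt.exists_normal {α : ℝ≥0} {Ω : Set E3} {P₀ : E3}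
    (hP : P₀ ∈ frontier Ω) (h : IsC1HolderGraphAt α Ω P₀) :
    ∃ n, IsExteriorUnitNormal Ω P₀ n := by
  obtain ⟨r, hr, i, σ, f, C, hσ, hf, -, hg⟩ := h
  let D : E3 →L[ℝ] E2 := LinearMap.toContinuousLinearMap
    { toFun := dropCoord i
      map_add' := fun x y => by ext j; simp [dropCoord]
      map_smul' := fun c x => by ext j; simp [dropCoord] }
  have hD : ∀ P, D P = dropCoord i P := fun P => rfl
  have hfd : HasFDerivAt f (fderiv ℝ f (D P₀)) (D P₀) :=
    ((hf.contDiffAt (isOpen_ball.mem_nhds (mem_ball_self hr))).differentiableAt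
      (by norm_num)).hasFDerivAt
  let L : E3 →L[ℝ] ℝ := EuclideanSpace.proj i - (fderiv ℝ f (D P₀)).comp D
  have hL : HasFDerivAt (fun P : E3 => P i - f (D P)) L P₀ :=
    ((EuclideanSpace.proj i : E3 →L[ℝ] ℝ).hasFDerivAt).sub (hfd.comp P₀ D.hasFDerivAt)
  let w : E3 := (InnerProductSpace.toDual ℝ E3).symm L
  have hw : ∀ v, ⟪w, v⟫ = L v := fun v => by simp [w]
  have hw0 : 0 < ‖w‖ := by
    refine norm_pos_iff.2 fun h0 => ?_
    have h1 := hw (EuclideanSpace.single i 1)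
    have h2 : D (EuclideanSpace.single i 1) = 0 := by
      ext j; simp [hD, dropCoord]
    rw [h0, inner_zero_left] at h1
    simp [L, h2] at h1
  have hz : P₀ i - f (D P₀) = 0 := sub_eq_zero.2 ((hg P₀ (mem_ball_self hr)).2.1 hP)
  have hσ2 : |σ| = 1 := by rcases hσ with rfl | rfl <;> simp
  refine ⟨(σ / ‖w‖) • w, ?_, fun ε hε => ?_⟩
  · rw [norm_smul, norm_div, norm_norm, Real.norm_eq_abs, hσ2]
    field_simp
  have hbound := hL.isLittleO.def (mul_pos hε hw0)
  filter_upwards [hbound, ball_mem_nhds P₀ hr] with Q hQ hQr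
  rw [hz, sub_zero, ← hw, Real.norm_eq_abs] at hQ
  have key : |σ * (Q i - f (dropCoord i Q)) - σ * ⟪w, Q - P₀⟫| ≤ ε * ‖w‖ * ‖Q - P₀‖ := by
    rw [← mul_sub, abs_mul, hσ2, one_mul]; exact hQ
  have hin : σ * ⟪w, Q - P₀⟫ = ‖w‖ * ⟪Q - P₀, (σ / ‖w‖) • w⟫ := by
    rw [real_inner_smul_right, real_inner_comm]; field_simp
  rw [hin, abs_le] at key
  obtain ⟨g1, g2⟩ := hg Q hQr
  constructor
  · intro hlt hcl
    have := mul_lt_mul_of_pos_left hlt hw0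
    have hpos : 0 < σ * (Q i - f (dropCoord i Q)) := by nlinarith [key.1]
    rw [closure_eq_self_union_frontier] at hcl
    rcases hcl with hcl | hcl
    · exact absurd (g1.1 hcl) (by linarith)
    · rw [g2.1 hcl] at hpos; simp at hpos
  · intro hlt
    have := mul_lt_mul_of_pos_left hlt hw0
    exact g1.2 (by nlinarith [key.2])

/-- On a `C^{1,α}` boundary, `exteriorNormal` is the exterior unit normal. -/
theorem HasC1HolderBoundary.exteriorNormal_spec {α : ℝ≥0} {Ω : Set E3} {P : E3}
    (h : HasC1HolderBoundary α Ω) (hP : P ∈ frontier Ω) :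
    IsExteriorUnitNormal Ω P (exteriorNormal Ω P) := by
  have hex := (h P hP).exists_normal hP
  rw [exteriorNormal, dif_pos hex]
  exact hex.choose_spec

/-! The boundary is compact, so it is enough to bound the integrals over a small piece, uniformly in
`M`. Write the piece as a graph of `f` over a disc, let `x` and `m` be the projections of `P` and
`M`, and put `ρ = |x - m|`, `R = |P - M|`, and `d = |M i - f m|`, the vertical distance from `M` to
the graph.

Up to a factor at most `1`, the numerator is `|f x - M i - f'(x)(x - m)|`. By Taylor's formula with
Hölder derivative it is at most `C ρ^(1+α) + d`. Since `ρ ≤ R`, the first term over `R³` is at most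
`C ρ^(α-2)`, a Riesz kernel integrable on plane discs. Since `f` is Lipschitz, `R²` dominates a
multiple of `ρ² + d²`, so the second is at most a constant times `d (ρ² + d²)^(-3/2)`, whose
integral over the plane is scale invariant, hence bounded independently of `d`
(`div_cube_le_riesz_add_poisson`).

Projection is antilipschitz on the graph, which carries surface integrals to the plane
(`setLIntegral_comp_le_of_antilipschitz`). If `m` is outside the chart disc, `R` is bounded below
and the integrand is bounded. -/

/-! ### Kernel integrals in the plane. -/

/-- The `L¹` norm of the Poisson-type kernel `d (|x - m|² + d²)^(-3/2)` on the plane is bounded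
independently of `d` and `m`. -/
theorem lintegral_poissonKernel_le (m : E2) {d : ℝ} (hd : 0 ≤ d) :
    ∫⁻ x : E2, ENNReal.ofReal (d * (‖x - m‖ ^ 2 + d ^ 2) ^ (-3 / 2 : ℝ)) ≤
      ∫⁻ y : E2, ENNReal.ofReal ((1 + ‖y‖ ^ 2) ^ (-3 / 2 : ℝ)) := by
  rcases hd.eq_or_lt with rfl | hd
  · simp
  rw [lintegral_sub_right_eq_self (fun x : E2 =>
    ENNReal.ofReal (d * (‖x‖ ^ 2 + d ^ 2) ^ (-3 / 2 : ℝ))) m]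
  set F : E2 → ENNReal := fun y => ENNReal.ofReal ((1 + ‖y‖ ^ 2) ^ (-3 / 2 : ℝ)) with hF
  have hFm : Measurable F := by
    rw [hF]; fun_prop
  have h1 : ∀ x : E2, ENNReal.ofReal (d * (‖x‖ ^ 2 + d ^ 2) ^ (-3 / 2 : ℝ)) =
      ENNReal.ofReal ((d ^ 2)⁻¹) * F (d⁻¹ • x) := by
    intro x
    rw [hF, ← ENNReal.ofReal_mul (by positivity)]
    congr 1
    have e : ‖x‖ ^ 2 + d ^ 2 = d ^ 2 * (1 + ‖d⁻¹ • x‖ ^ 2) := by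
      rw [norm_smul, norm_inv, Real.norm_of_nonneg hd.le]
      field_simp
      ring
    rw [e, Real.mul_rpow (by positivity) (by positivity), ← mul_assoc]
    congr 1
    rw [← Real.rpow_natCast, ← Real.rpow_mul hd.le, ← Real.rpow_neg hd.le]
    nth_rw 1 [← Real.rpow_one d]
    rw [← Real.rpow_add hd]
    norm_num
  simp_rw [h1]
  have hFs : Measurable fun x => F (d⁻¹ • x) := hFm.comp (measurable_const_smul d⁻¹)
  rw [lintegral_const_mul _ hFs,
    ← lintegral_map (f := F) hFm (measurable_const_smul d⁻¹),
    Measure.map_addHaar_smul _ (inv_ne_zero hd.ne'), lintegral_smul_measure, smul_eq_mul,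
    ← mul_assoc, ← ENNReal.ofReal_mul (by positivity)]
  -- The Jacobian `d²` of `x = d y` cancels the homogeneity factor `d⁻²` of the kernel.
  have : (d ^ 2)⁻¹ * |(d⁻¹ ^ Module.finrank ℝ E2)⁻¹| = 1 := by
    rw [finrank_euclideanSpace_fin, inv_pow, inv_inv, abs_of_nonneg (by positivity)]
    field_simp
  rw [this]
  simp

/-- Decay of order `3` exceeds the dimension `2`. -/
theorem lintegral_one_add_norm_sq_rpow_lt_top :
    ∫⁻ y : E2, ENNReal.ofReal ((1 + ‖y‖ ^ 2) ^ (-3 / 2 : ℝ)) < ⊤ :=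
  (integrable_rpow_neg_one_add_norm_sq (E := E2) (μ := volume) (r := 3)
    (by rw [finrank_euclideanSpace_fin]; norm_num)).lintegral_lt_top

/-- The Riesz kernel `|x|^(α-2)` is integrable over discs. -/
theorem lintegral_ball_norm_rpow_lt_top {α : ℝ} (hα : 0 < α) (R : ℝ) :
    ∫⁻ x : E2 in ball 0 R, ENNReal.ofReal (‖x‖ ^ (α - 2)) < ⊤ := by
  refine IntegrableOn.setLIntegral_lt_top
    ((integrableOn_fun_norm_addHaar volume (f := fun t : ℝ => t ^ (α - 2))).2 ?_)
  rw [finrank_euclideanSpace_fin]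
  -- In polar coordinates the weight `t` turns `t^(α-2)` into `t^(α-1)`, with exponent above `-1`.
  have h : IntegrableOn (fun t : ℝ => t ^ (α - 1)) (Ioo 0 R) := by
    rcases le_or_gt R 0 with hR | hR
    · simp [Ioo_eq_empty (not_lt.2 hR)]
    · exact (intervalIntegral.integrableOn_Ioo_rpow_iff hR).2 (by linarith)
  refine h.congr_fun (fun t ht => ?_) measurableSet_Ioo
  simp only [smul_eq_mul]
  rw [← Real.rpow_natCast, ← Real.rpow_add ht.1]
  congr 1
  norm_num
  ring

/-- Translating by `m` keeps the disc inside a fixed disc about the origin, so the bound does not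
depend on `m`. -/
theorem lintegral_ball_norm_sub_rpow_le (α : ℝ) {p m : E2} {s r : ℝ} (hm : m ∈ ball p r) :
    ∫⁻ x in ball p s, ENNReal.ofReal (‖x - m‖ ^ (α - 2)) ≤
      ∫⁻ x : E2 in ball 0 (s + r), ENNReal.ofReal (‖x‖ ^ (α - 2)) := by
  rw [← lintegral_indicator measurableSet_ball, ← lintegral_indicator measurableSet_ball]
  refine le_trans (lintegral_mono fun x => ?_) (lintegral_sub_right_eq_self _ m).le
  refine indicator_apply_le' (fun hx => ?_) (fun _ => zero_le)
  rw [indicator_of_mem]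
  rw [mem_ball_zero_iff, ← dist_eq_norm]
  calc dist x m ≤ dist x p + dist m p := dist_triangle_right _ _ _
    _ < s + r := add_lt_add hx hm

/-- If `N ≤ C ρ^(1+α) + d` where `ρ ≤ R` and `d ≤ (K + 1) R`, then `N / R³` is dominated by
a Riesz kernel plus a multiple of a Poisson-type kernel. -/
theorem div_cube_le_riesz_add_poisson {α ρ R d C K N : ℝ} (hα : 0 < α) (hρ : 0 ≤ ρ) (hd : 0 ≤ d)
    (hC : 0 ≤ C) (hρR : ρ ≤ R) (hdR : d ≤ (K + 1) * R) (hN : N ≤ C * ρ ^ (1 + α) + d) :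
    N / R ^ 3 ≤ C * ρ ^ (α - 2) +
      (1 + (K + 1) ^ 2) ^ (3 / 2 : ℝ) * (d * (ρ ^ 2 + d ^ 2) ^ (-3 / 2 : ℝ)) := by
  have hR : 0 ≤ R := hρ.trans hρR
  rcases hR.eq_or_lt with rfl | hR
  · simp only [ne_eq, OfNat.ofNat_ne_zero, not_false_eq_true, zero_pow, div_zero]
    positivity
  have h1 : ρ ^ (1 + α) / R ^ 3 ≤ ρ ^ (α - 2) := by
    rcases hρ.eq_or_lt with rfl | hρ
    · rw [Real.zero_rpow (by positivity), zero_div]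
      positivity
    · have : ρ ^ (1 + α) = ρ ^ (α - 2) * ρ ^ 3 := by
        rw [← Real.rpow_natCast, ← Real.rpow_add hρ]
        congr 1
        norm_num
        ring
      rw [div_le_iff₀ (by positivity), this]
      gcongr
  have h2 : d / R ^ 3 ≤
      (1 + (K + 1) ^ 2) ^ (3 / 2 : ℝ) * (d * (ρ ^ 2 + d ^ 2) ^ (-3 / 2 : ℝ)) := by
    rcases hd.eq_or_lt with rfl | hd
    · simp
    have hpos : 0 < ρ ^ 2 + d ^ 2 := by positivity
    -- This is the power `3/2` of `ρ² + d² ≤ (1 + (K + 1)²) R²`.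
    have h3 : (ρ ^ 2 + d ^ 2) ^ (3 / 2 : ℝ) ≤ (1 + (K + 1) ^ 2) ^ (3 / 2 : ℝ) * R ^ 3 := by
      have e : R ^ 3 = (R ^ 2) ^ (3 / 2 : ℝ) := by
        rw [← Real.rpow_natCast, ← Real.rpow_natCast, ← Real.rpow_mul hR.le]
        norm_num
      rw [e, ← Real.mul_rpow (by positivity) (by positivity)]
      refine Real.rpow_le_rpow hpos.le ?_ (by norm_num)
      have a : ρ ^ 2 ≤ R ^ 2 := by gcongr
      have b : d ^ 2 ≤ ((K + 1) * R) ^ 2 := by gcongr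
      linarith [mul_pow (K + 1) R 2]
    rw [neg_div, Real.rpow_neg hpos.le, div_le_iff₀ (by positivity)]
    have h4 : 0 < (ρ ^ 2 + d ^ 2) ^ (3 / 2 : ℝ) := by positivity
    calc d = d * ((ρ ^ 2 + d ^ 2) ^ (3 / 2 : ℝ))⁻¹ * (ρ ^ 2 + d ^ 2) ^ (3 / 2 : ℝ) := by
          field_simp
      _ ≤ d * ((ρ ^ 2 + d ^ 2) ^ (3 / 2 : ℝ))⁻¹ *
            ((1 + (K + 1) ^ 2) ^ (3 / 2 : ℝ) * R ^ 3) := by gcongr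
      _ = _ := by ring
  calc N / R ^ 3 ≤ (C * ρ ^ (1 + α) + d) / R ^ 3 := by gcongr
    _ = C * (ρ ^ (1 + α) / R ^ 3) + d / R ^ 3 := by ring
    _ ≤ _ := by gcongr

/-! ### Coordinates and the normal of a graph. -/

/-- `dropCoord i` as a continuous linear map. -/
noncomputable def dropCoordL (i : Fin 3) : E3 →L[ℝ] E2 :=
  LinearMap.toContinuousLinearMap
    { toFun := dropCoord i
      map_add' := fun x y => by ext j; simp [dropCoord]
      map_smul' := fun c x => by ext j; simp [dropCoord] }

@[simp]
theorem dropCoordL_apply (i : Fin 3) (P : E3) : dropCoordL i P = dropCoord i P := rfl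

theorem norm_sq_eq_coord_sq_add (i : Fin 3) (v : E3) :
    ‖v‖ ^ 2 = v i ^ 2 + ‖dropCoord i v‖ ^ 2 := by
  rw [EuclideanSpace.real_norm_sq_eq, EuclideanSpace.real_norm_sq_eq,
    Fin.sum_univ_succAbove _ i]
  rfl

theorem norm_dropCoord_le (i : Fin 3) (v : E3) : ‖dropCoord i v‖ ≤ ‖v‖ := by
  refine (sq_le_sq₀ (norm_nonneg _) (norm_nonneg _)).1 ?_
  rw [norm_sq_eq_coord_sq_add i v]
  nlinarith [sq_nonneg (v i)]

theorem abs_coord_le_norm (i : Fin 3) (v : E3) : |v i| ≤ ‖v‖ := by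
  refine (sq_le_sq₀ (abs_nonneg _) (norm_nonneg _)).1 ?_
  rw [norm_sq_eq_coord_sq_add i v, sq_abs]
  nlinarith [sq_nonneg ‖dropCoord i v‖]

theorem norm_le_abs_coord_add (i : Fin 3) (v : E3) : ‖v‖ ≤ |v i| + ‖dropCoord i v‖ := by
  refine (sq_le_sq₀ (norm_nonneg _) (by positivity)).1 ?_
  rw [norm_sq_eq_coord_sq_add i v, ← sq_abs (v i)]
  nlinarith [mul_nonneg (abs_nonneg (v i)) (norm_nonneg (dropCoord i v))]

theorem dropCoord_sub (i : Fin 3) (P Q : E3) :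
    dropCoord i (P - Q) = dropCoord i P - dropCoord i Q :=
  map_sub (dropCoordL i) P Q

theorem dropCoord_mem_ball {i : Fin 3} {P Q : E3} {r : ℝ} (h : P ∈ ball Q r) :
    dropCoord i P ∈ ball (dropCoord i Q) r := by
  rw [mem_ball, dist_eq_norm] at h ⊢
  rw [← dropCoord_sub]
  exact (norm_dropCoord_le i _).trans_lt h

/-- The vector `(-A, 1)`, normal to a graph `P i = f (dropCoord i P)` at a point where `f` has
derivative `A`. -/
noncomputable def graphNormalVec (i : Fin 3) (A : E2 →L[ℝ] ℝ) : E3 :=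
  (InnerProductSpace.toDual ℝ E3).symm (EuclideanSpace.proj i - A.comp (dropCoordL i))

theorem inner_graphNormalVec (i : Fin 3) (A : E2 →L[ℝ] ℝ) (v : E3) :
    ⟪v, graphNormalVec i A⟫ = v i - A (dropCoord i v) := by
  rw [real_inner_comm, graphNormalVec, InnerProductSpace.toDual_symm_apply]
  rfl

/-- Its inner product with the `i`-th unit vector is `1`. Hence normalizing the vector can only
decrease the solid angle integrand. -/
theorem one_le_norm_graphNormalVec (i : Fin 3) (A : E2 →L[ℝ] ℝ) : 1 ≤ ‖graphNormalVec i A‖ := by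
  have h1 := inner_graphNormalVec i A (EuclideanSpace.single i 1)
  have h2 : dropCoord i (EuclideanSpace.single i (1 : ℝ)) = 0 := by
    ext j; simp [dropCoord]
  have h3 := real_inner_le_norm (EuclideanSpace.single i (1 : ℝ)) (graphNormalVec i A)
  rw [h1, h2] at h3
  simpa using h3

theorem continuous_graphNormalVec (i : Fin 3) : Continuous (graphNormalVec i) := by
  unfold graphNormalVec
  refine (LinearIsometryEquiv.continuous _).comp (continuous_const.sub ?_)
  exact ((ContinuousLinearMap.compL ℝ E3 E2 ℝ).flip (dropCoordL i)).continuous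

/-- Where `∂Ω` is the graph of `f`, with `Ω` on the side `σ (P i - f) < 0`, the normalization of
`σ (-∇f, 1)` is the exterior unit normal. -/
theorem isExteriorUnitNormal_of_graph {Ω : Set E3} {P : E3} {i : Fin 3} {σ : ℝ} {f : E2 → ℝ}
    (hσ : σ = 1 ∨ σ = -1) (hf : DifferentiableAt ℝ f (dropCoord i P)) (hP : P ∈ frontier Ω)
    (hg : ∀ᶠ Q in 𝓝 P, (Q ∈ Ω ↔ σ * (Q i - f (dropCoord i Q)) < 0) ∧
      (Q ∈ frontier Ω ↔ Q i = f (dropCoord i Q))) :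
    IsExteriorUnitNormal Ω P ((σ / ‖graphNormalVec i (fderiv ℝ f (dropCoord i P))‖) •
      graphNormalVec i (fderiv ℝ f (dropCoord i P))) := by
  set w := graphNormalVec i (fderiv ℝ f (dropCoord i P)) with hw
  have hL : HasFDerivAt (fun Q : E3 => Q i - f (dropCoordL i Q))
      (EuclideanSpace.proj i - (fderiv ℝ f (dropCoord i P)).comp (dropCoordL i)) P :=
    ((EuclideanSpace.proj i : E3 →L[ℝ] ℝ).hasFDerivAt).sub
      (HasFDerivAt.comp P (f := dropCoordL i) hf.hasFDerivAt (dropCoordL i).hasFDerivAt)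
  have hw0 : 0 < ‖w‖ := zero_lt_one.trans_le (one_le_norm_graphNormalVec _ _)
  have hz : P i - f (dropCoord i P) = 0 := sub_eq_zero.2 (hg.self_of_nhds.2.1 hP)
  have hσ2 : |σ| = 1 := by rcases hσ with rfl | rfl <;> simp
  refine ⟨?_, fun ε hε => ?_⟩
  · rw [norm_smul, norm_div, norm_norm, Real.norm_eq_abs, hσ2]
    field_simp
  filter_upwards [hL.isLittleO.def (mul_pos hε hw0), hg] with Q hQ hgQ
  obtain ⟨g1, g2⟩ := hgQ
  have hQ' : |Q i - f (dropCoord i Q) - ⟪Q - P, w⟫| ≤ ε * ‖w‖ * ‖Q - P‖ := by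
    rw [hw, inner_graphNormalVec]
    simpa [hz, dropCoord_sub] using hQ
  have key : |σ * (Q i - f (dropCoord i Q)) - σ * ⟪Q - P, w⟫| ≤ ε * ‖w‖ * ‖Q - P‖ := by
    rwa [← mul_sub, abs_mul, hσ2, one_mul]
  have hin : σ * ⟪Q - P, w⟫ = ‖w‖ * ⟪Q - P, (σ / ‖w‖) • w⟫ := by
    rw [real_inner_smul_right]; field_simp
  rw [hin, abs_le] at key
  constructor
  · intro hlt hcl
    have := mul_lt_mul_of_pos_left hlt hw0
    have hpos : 0 < σ * (Q i - f (dropCoord i Q)) := by nlinarith [key.1]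
    rw [closure_eq_self_union_frontier] at hcl
    rcases hcl with hcl | hcl
    · exact absurd (g1.1 hcl) (by linarith)
    · rw [g2.1 hcl] at hpos; simp at hpos
  · intro hlt
    have := mul_lt_mul_of_pos_left hlt hw0
    exact g1.2 (by nlinarith [key.2])

theorem exteriorNormal_eq_of_isExteriorUnitNormal {Ω : Set E3} {P n : E3}
    (h : IsExteriorUnitNormal Ω P n) : exteriorNormal Ω P = n := by
  have hex : ∃ n, IsExteriorUnitNormal Ω P n := ⟨n, h⟩
  rw [exteriorNormal, dif_pos hex]
  exact hex.choose_spec.unique h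

/-- The exterior normal in a chart. -/
theorem exteriorNormal_eq_of_graph {Ω : Set E3} {P₀ : E3} {r : ℝ} {i : Fin 3} {σ : ℝ} {f : E2 → ℝ}
    (hσ : σ = 1 ∨ σ = -1) (hf : ContDiffOn ℝ 1 f (ball (dropCoord i P₀) r))
    (hg : ∀ P ∈ ball P₀ r, (P ∈ Ω ↔ σ * (P i - f (dropCoord i P)) < 0) ∧
      (P ∈ frontier Ω ↔ P i = f (dropCoord i P)))
    {P : E3} (hP : P ∈ frontier Ω) (hPr : P ∈ ball P₀ r) :
    exteriorNormal Ω P = (σ / ‖graphNormalVec i (fderiv ℝ f (dropCoord i P))‖) •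
      graphNormalVec i (fderiv ℝ f (dropCoord i P)) := by
  refine exteriorNormal_eq_of_isExteriorUnitNormal (isExteriorUnitNormal_of_graph hσ ?_ hP ?_)
  · exact (hf.contDiffAt (isOpen_ball.mem_nhds (dropCoord_mem_ball hPr))).differentiableAt
      (by norm_num)
  · filter_upwards [isOpen_ball.mem_nhds hPr] with Q hQ using hg Q hQ

/-- The exterior normal is continuous on a `C^{1,α}` boundary. -/
theorem HasC1HolderBoundary.continuousOn_exteriorNormal {α : ℝ≥0} {Ω : Set E3}
    (h : HasC1HolderBoundary α Ω) : ContinuousOn (exteriorNormal Ω) (frontier Ω) := by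
  intro P₀ hP₀
  obtain ⟨r, hr, i, σ, f, C, hσ, hf, -, hg⟩ := h P₀ hP₀
  have hfd : ContinuousAt (fun P => graphNormalVec i (fderiv ℝ f (dropCoordL i P))) P₀ := by
    have h1 : ContinuousAt (fderiv ℝ f) (dropCoordL i P₀) :=
      (hf.contDiffAt (isOpen_ball.mem_nhds (mem_ball_self hr))).continuousAt_fderiv one_ne_zero
    exact (continuous_graphNormalVec i).continuousAt.comp
      (h1.comp (f := dropCoordL i) (dropCoordL i).continuous.continuousAt)
  have hn : ‖graphNormalVec i (fderiv ℝ f (dropCoordL i P₀))‖ ≠ 0 :=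
    (zero_lt_one.trans_le (one_le_norm_graphNormalVec _ _)).ne'
  refine (((continuousAt_const.div hfd.norm hn).smul hfd).continuousWithinAt).congr_of_eventuallyEq
    ?_ (exteriorNormal_eq_of_graph hσ hf hg hP₀ (mem_ball_self hr))
  filter_upwards [self_mem_nhdsWithin, mem_nhdsWithin_of_mem_nhds (ball_mem_nhds P₀ hr)]
    with P h1 h2 using exteriorNormal_eq_of_graph hσ hf hg h1 h2

/-! ### Comparison of surface measure with plane measure. -/

/-- A set on which a map `D` is antilipschitz has Hausdorff measure controlled by that of its
image. -/
theorem euclideanHausdorffMeasure_inter_preimage_le {X Y : Type*} [MetricSpace X]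
    [MeasurableSpace X] [BorelSpace X] [MetricSpace Y] [MeasurableSpace Y] [BorelSpace Y]
    {D : X → Y} {S : Set X} {K : ℝ≥0} (hD : ∀ P ∈ S, ∀ Q ∈ S, dist P Q ≤ K * dist (D P) (D Q))
    (d : ℕ) (A : Set Y) :
    (Measure.euclideanHausdorffMeasure d : Measure X) (S ∩ D ⁻¹' A) ≤
      (K : ENNReal) ^ d * (Measure.euclideanHausdorffMeasure d : Measure Y) A := by
  set T := S ∩ D ⁻¹' A with hT
  rcases T.eq_empty_or_nonempty with h0 | ⟨P₁, hP₁⟩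
  · simp [h0]
  have : Nonempty X := ⟨P₁⟩
  have hinj : InjOn D T := fun P hP Q hQ h => by
    have := hD P hP.1 Q hQ.1
    rw [h, dist_self, mul_zero] at this
    exact dist_le_zero.1 this
  -- `T` is the image of `D '' T` under the inverse of `D`, which is `K`-Lipschitz there.
  set g := Function.invFunOn D T with hg
  have hgl : ∀ P ∈ T, g (D P) = P := fun P hP => hinj.leftInvOn_invFunOn hP
  have hgT : g '' (D '' T) = T := by
    rw [image_image]
    exact (image_congr hgl).trans (image_id' T)
  have hlip : LipschitzOnWith K g (D '' T) := by
    refine LipschitzOnWith.of_dist_le_mul ?_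
    rintro _ ⟨P, hP, rfl⟩ _ ⟨Q, hQ, rfl⟩
    rw [hgl P hP, hgl Q hQ]
    exact hD P hP.1 Q hQ.1
  have h1 := hlip.hausdorffMeasure_image_le (d := d) (Nat.cast_nonneg d)
  rw [hgT, ENNReal.rpow_natCast] at h1
  have h2 : D '' T ⊆ A := by
    rintro _ ⟨P, hP, rfl⟩
    exact hP.2
  rw [Measure.euclideanHausdorffMeasure_def, Measure.euclideanHausdorffMeasure_def,
    Measure.smul_apply, Measure.smul_apply, mul_smul_comm]
  gcongr
  exact h1.trans (by gcongr)

/-- Integrals over a set on which `D` is antilipschitz are bounded by integrals over the plane. -/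
theorem setLIntegral_comp_le_of_antilipschitz {D : E3 → E2} (hDc : Continuous D) {S : Set E3}
    {K : ℝ≥0} (hD : ∀ P ∈ S, ∀ Q ∈ S, dist P Q ≤ K * dist (D P) (D Q))
    {B : Set E2} (hSB : MapsTo D S B)
    {G : E2 → ENNReal} (hG : Measurable G) :
    ∫⁻ P in S, G (D P) ∂(Measure.euclideanHausdorffMeasure 2) ≤
      (K : ENNReal) ^ 2 * ∫⁻ x in B, G x := by
  rw [← lintegral_map (μ := (Measure.euclideanHausdorffMeasure 2).restrict S) hG hDc.measurable,
    ← smul_eq_mul, ← lintegral_smul_measure]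
  -- It suffices to compare measures: the pushforward of surface measure on `S` is at most `K²`
  -- times area on `B`.
  refine lintegral_mono' (Measure.le_iff.2 fun A hA => ?_) le_rfl
  rw [Measure.map_apply hDc.measurable hA, Measure.restrict_apply (hDc.measurable hA),
    Measure.smul_apply, Measure.restrict_apply hA, smul_eq_mul,
    ← EuclideanSpace.euclideanHausdorffMeasure_eq_volume 2]
  refine le_trans (measure_mono fun P hP => ?_)
    (euclideanHausdorffMeasure_inter_preimage_le hD 2 (A ∩ B))
  exact ⟨hP.2, hP.1, hSB hP.2⟩

/-! ### Taylor and Lipschitz estimates. -/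

/-- First order Taylor estimate for a function with Hölder continuous derivative. -/
theorem abs_sub_sub_fderiv_le_of_holderOnWith {f : E2 → ℝ} {s : Set E2} {C α : ℝ≥0}
    (hs : Convex ℝ s) (hf : ∀ x ∈ s, DifferentiableAt ℝ f x) (hH : HolderOnWith C α (fderiv ℝ f) s)
    {x m : E2} (hx : x ∈ s) (hm : m ∈ s) :
    |f x - f m - fderiv ℝ f x (x - m)| ≤ C * ‖x - m‖ ^ (1 + α : ℝ) := by
  have hseg := hs.segment_subset hm hx
  have hα : (0 : ℝ) ≤ α := α.coe_nonneg
  -- Mean value inequality for `f` minus the linear map `f'(x)`. The derivative is frozen at `x`,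
  -- not `m`, because the normal is taken at the boundary point.
  have h := (convex_segment m x).norm_image_sub_le_of_norm_hasFDerivWithin_le'
    (f := f) (f' := fderiv ℝ f) (φ := fderiv ℝ f x) (C := C * ‖x - m‖ ^ (α : ℝ))
    (fun y hy => (hf y (hseg hy)).hasFDerivAt.hasFDerivWithinAt)
    (fun y hy => ?_) (left_mem_segment ℝ m x) (right_mem_segment ℝ m x)
  · rw [Real.norm_eq_abs] at h
    refine h.trans (le_of_eq ?_)
    rw [Real.rpow_add_of_nonneg (norm_nonneg _) zero_le_one hα, Real.rpow_one]
    ring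
  · rw [← dist_eq_norm]
    refine hH.dist_le_of_le (hseg hy) hx ?_
    rw [dist_comm, ← dist_eq_norm, dist_comm x m]
    rw [← dist_add_dist_of_mem_segment hy]
    linarith [dist_nonneg (x := m) (y := y), dist_comm x y]

/-- A function with Hölder continuous derivative on a ball is Lipschitz there. -/
theorem exists_abs_sub_le_of_holderOnWith {f : E2 → ℝ} {p : E2} {r : ℝ} {C α : ℝ≥0} (hr : 0 < r)
    (hf : ∀ x ∈ ball p r, DifferentiableAt ℝ f x)
    (hH : HolderOnWith C α (fderiv ℝ f) (ball p r)) :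
    ∃ K : ℝ≥0, ∀ x ∈ ball p r, ∀ y ∈ ball p r, |f x - f y| ≤ K * ‖x - y‖ := by
  have hK : 0 ≤ ‖fderiv ℝ f p‖ + C * r ^ (α : ℝ) := by positivity
  refine ⟨⟨_, hK⟩, fun x hx y hy => ?_⟩
  refine (convex_ball p r).norm_image_sub_le_of_norm_fderiv_le hf (fun z hz => ?_) hy hx
  have h1 := hH.dist_le_of_le hz (mem_ball_self hr) (le_of_lt hz)
  rw [dist_eq_norm] at h1
  exact (norm_le_norm_add_norm_sub' _ _).trans (add_le_add_right h1 _)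

/-! ### Local and global bounds. -/

/-- In a chart, the absolute solid angle integrand is dominated by the same quotient with the
unnormalized normal. -/
theorem solidAngleIntegrand_le_of_graph {Ω : Set E3} {P₀ : E3} {r : ℝ} {i : Fin 3} {σ : ℝ}
    {f : E2 → ℝ} (hσ : σ = 1 ∨ σ = -1) (hf : ContDiffOn ℝ 1 f (ball (dropCoord i P₀) r))
    (hg : ∀ P ∈ ball P₀ r, (P ∈ Ω ↔ σ * (P i - f (dropCoord i P)) < 0) ∧
      (P ∈ frontier Ω ↔ P i = f (dropCoord i P)))
    {P : E3} (hP : P ∈ frontier Ω) (hPr : P ∈ ball P₀ r) (M : E3) :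
    solidAngleIntegrand Ω M P ≤
      |(P - M) i - fderiv ℝ f (dropCoord i P) (dropCoord i (P - M))| / ‖P - M‖ ^ 3 := by
  have hw := one_le_norm_graphNormalVec i (fderiv ℝ f (dropCoord i P))
  have hσ2 : |σ| = 1 := by rcases hσ with rfl | rfl <;> simp
  rw [solidAngleIntegrand, exteriorNormal_eq_of_graph hσ hf hg hP hPr, real_inner_smul_right,
    inner_graphNormalVec, abs_mul, abs_div, hσ2, abs_norm]
  gcongr
  refine mul_le_of_le_one_left (abs_nonneg _) ?_
  rw [div_le_one (by positivity)]
  exact hw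

theorem solidAngleIntegrand_nonneg (Ω : Set E3) (M P : E3) : 0 ≤ solidAngleIntegrand Ω M P := by
  unfold solidAngleIntegrand; positivity

/-- Cauchy–Schwarz; this serves when `M` stays away from the piece of boundary. -/
theorem solidAngleIntegrand_le_inv_sq {Ω : Set E3} {M P : E3} (h : ‖exteriorNormal Ω P‖ = 1) :
    solidAngleIntegrand Ω M P ≤ (‖P - M‖ ^ 2)⁻¹ := by
  have h1 := abs_real_inner_le_norm (P - M) (exteriorNormal Ω P)
  rw [h, mul_one] at h1
  unfold solidAngleIntegrand
  refine (div_le_div_of_nonneg_right h1 (by positivity)).trans (le_of_eq ?_)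
  rcases eq_or_ne ‖P - M‖ 0 with h0 | h0
  · simp [h0]
  · field_simp

/-- The absolute solid angle integrals over a small piece of the boundary are bounded. -/
theorem exists_setLIntegral_solidAngleIntegrand_le {α : ℝ≥0} (hα : 0 < α) {Ω : Set E3}
    (hΩ : HasC1HolderBoundary α Ω) {P₀ : E3} (hP₀ : P₀ ∈ frontier Ω) :
    ∃ s > 0, ∃ B < (⊤ : ENNReal), ∀ M : E3,
      ∫⁻ P in frontier Ω ∩ ball P₀ s, ENNReal.ofReal (solidAngleIntegrand Ω M P)
        ∂(Measure.euclideanHausdorffMeasure 2) ≤ B := by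
  obtain ⟨r, hr, i, σ, f, C, hσ, hf, hH, hg⟩ := hΩ P₀ hP₀
  have hfd : ∀ x ∈ ball (dropCoord i P₀) r, DifferentiableAt ℝ f x := fun x hx =>
    (hf.contDiffAt (isOpen_ball.mem_nhds hx)).differentiableAt (by norm_num)
  obtain ⟨K, hK⟩ := exists_abs_sub_le_of_holderOnWith hr hfd hH
  set p := dropCoord i P₀ with hp
  set S := frontier Ω ∩ ball P₀ (r / 2) with hS
  have hSr : ∀ P ∈ S, P ∈ ball P₀ r := fun P hP => ball_subset_ball (by linarith) hP.2
  have hSf : ∀ P ∈ S, P i = f (dropCoord i P) := fun P hP => (hg P (hSr P hP)).2.1 hP.1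
  have hSB : MapsTo (dropCoordL i) S (ball p (r / 2)) := fun P hP => dropCoord_mem_ball hP.2
  have hSp : ∀ P ∈ S, dropCoord i P ∈ ball p r := fun P hP => dropCoord_mem_ball (hSr P hP)
  have hD : ∀ P ∈ S, ∀ Q ∈ S,
      dist P Q ≤ (K + 1 : ℝ≥0) * dist (dropCoordL i P) (dropCoordL i Q) := by
    intro P hP Q hQ
    have h1 := norm_le_abs_coord_add i (P - Q)
    have h2 := hK _ (hSp P hP) _ (hSp Q hQ)
    rw [PiLp.sub_apply, hSf P hP, hSf Q hQ, dropCoord_sub] at h1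
    rw [dist_eq_norm, dist_eq_norm, dropCoordL_apply, dropCoordL_apply]
    push_cast
    linarith
  have hSm : MeasurableSet S := isClosed_frontier.measurableSet.inter measurableSet_ball
  set c : ℝ := (1 + ((K : ℝ) + 1) ^ 2) ^ (3 / 2 : ℝ) with hc
  have hc0 : 0 ≤ c := by positivity
  set I₁ := ∫⁻ x : E2 in ball 0 (r / 2 + r), ENNReal.ofReal (‖x‖ ^ ((α : ℝ) - 2)) with hI₁
  set I₂ := ∫⁻ y : E2, ENNReal.ofReal ((1 + ‖y‖ ^ 2) ^ (-3 / 2 : ℝ)) with hI₂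
  set B₁ := ((K + 1 : ℝ≥0) : ENNReal) ^ 2 *
    (ENNReal.ofReal C * I₁ + ENNReal.ofReal c * I₂) with hB₁
  set B₂ := ((K + 1 : ℝ≥0) : ENNReal) ^ 2 *
    (ENNReal.ofReal (((r / 2) ^ 2)⁻¹) * volume (ball p (r / 2))) with hB₂
  have hI₁t : I₁ < ⊤ := lintegral_ball_norm_rpow_lt_top (NNReal.coe_pos.2 hα) _
  have hI₂t : I₂ < ⊤ := lintegral_one_add_norm_sq_rpow_lt_top
  have hK2 : ((K + 1 : ℝ≥0) : ENNReal) ^ 2 < ⊤ := ENNReal.pow_lt_top ENNReal.coe_lt_top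
  refine ⟨r / 2, by positivity, max B₁ B₂, max_lt ?_ ?_, fun M => ?_⟩
  · exact ENNReal.mul_lt_top hK2 (ENNReal.add_lt_top.2
      ⟨ENNReal.mul_lt_top ENNReal.ofReal_lt_top hI₁t,
        ENNReal.mul_lt_top ENNReal.ofReal_lt_top hI₂t⟩)
  · exact ENNReal.mul_lt_top hK2 (ENNReal.mul_lt_top ENNReal.ofReal_lt_top measure_ball_lt_top)
  set m := dropCoord i M with hm
  by_cases hmr : m ∈ ball p r
  -- `M` projects into the chart disc: Taylor's formula at `x` and `m` is available.
  · refine le_trans ?_ (le_max_left _ _)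
    set d := |M i - f m| with hd
    have hd0 : 0 ≤ d := abs_nonneg _
    set G₁ : E2 → ENNReal := fun x => ENNReal.ofReal (‖x - m‖ ^ ((α : ℝ) - 2)) with hG₁
    set G₂ : E2 → ENNReal := fun x =>
      ENNReal.ofReal (d * (‖x - m‖ ^ 2 + d ^ 2) ^ (-3 / 2 : ℝ)) with hG₂
    have hG₁m : Measurable G₁ := by rw [hG₁]; fun_prop
    have hG₂m : Measurable G₂ := by rw [hG₂]; fun_prop
    calc ∫⁻ P in S, ENNReal.ofReal (solidAngleIntegrand Ω M P)
          ∂(Measure.euclideanHausdorffMeasure 2)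
        ≤ ∫⁻ P in S, (fun x => ENNReal.ofReal C * G₁ x + ENNReal.ofReal c * G₂ x) (dropCoordL i P)
            ∂(Measure.euclideanHausdorffMeasure 2) := by
          refine setLIntegral_mono' hSm fun P hP => ?_
          simp only [hG₁, hG₂]
          rw [← ENNReal.ofReal_mul C.coe_nonneg, ← ENNReal.ofReal_mul hc0,
            ← ENNReal.ofReal_add (by positivity) (by positivity)]
          refine ENNReal.ofReal_le_ofReal
            ((solidAngleIntegrand_le_of_graph hσ hf hg hP.1 (hSr P hP) M).trans ?_)
          have hT := abs_sub_sub_fderiv_le_of_holderOnWith (convex_ball p r) hfd hH (hSp P hP) hmr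
          have hKx := hK _ (hSp P hP) _ hmr
          have h1 := norm_dropCoord_le i (P - M)
          have h2 := abs_coord_le_norm i (P - M)
          rw [dropCoord_sub] at h1
          rw [PiLp.sub_apply, hSf P hP] at h2
          rw [dropCoord_sub, PiLp.sub_apply, hSf P hP, dropCoordL_apply]
          refine div_cube_le_riesz_add_poisson (NNReal.coe_pos.2 hα) (norm_nonneg _) hd0
            C.coe_nonneg h1 ?_ ?_
          -- `d ≤ K ρ + R ≤ (K + 1) R`, by passing through the height `f x` of `P`.
          · have : d ≤ |f (dropCoord i P) - f m| + |f (dropCoord i P) - M i| := by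
              rw [hd]
              refine le_trans (le_of_eq ?_) (abs_sub _ _)
              congr 1
              ring
            nlinarith [K.coe_nonneg, mul_le_mul_of_nonneg_left h1 K.coe_nonneg]
          · refine le_trans ?_ (add_le_add_left hT d)
            refine le_trans (le_of_eq ?_) (abs_sub _ _)
            congr 1
            ring
      _ ≤ ((K + 1 : ℝ≥0) : ENNReal) ^ 2 * ∫⁻ x in ball p (r / 2),
            (ENNReal.ofReal C * G₁ x + ENNReal.ofReal c * G₂ x) :=
          setLIntegral_comp_le_of_antilipschitz (dropCoordL i).continuous hD hSB
            ((hG₁m.const_mul _).add (hG₂m.const_mul _))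
      _ ≤ B₁ := by
          rw [lintegral_add_left (hG₁m.const_mul _), lintegral_const_mul _ hG₁m,
            lintegral_const_mul _ hG₂m, hB₁]
          gcongr
          · exact lintegral_ball_norm_sub_rpow_le α hmr
          · exact (setLIntegral_le_lintegral _ _).trans (lintegral_poissonKernel_le m hd0)
  -- `m` is at least `r` from the centre and `P` projects within `r / 2` of it, so `|P - M| ≥ r /
  -- 2`.
  · refine le_trans ?_ (le_max_right _ _)
    calc ∫⁻ P in S, ENNReal.ofReal (solidAngleIntegrand Ω M P)
          ∂(Measure.euclideanHausdorffMeasure 2)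
        ≤ ∫⁻ P in S, (fun _ => ENNReal.ofReal (((r / 2) ^ 2)⁻¹)) (dropCoordL i P)
            ∂(Measure.euclideanHausdorffMeasure 2) := by
          refine setLIntegral_mono' hSm fun P hP => ENNReal.ofReal_le_ofReal ?_
          refine (solidAngleIntegrand_le_inv_sq (hΩ.exteriorNormal_spec hP.1).1).trans ?_
          have h1 := norm_dropCoord_le i (P - M)
          have h2 : dist (dropCoord i P) p < r / 2 := hSB hP
          have h3 : r ≤ dist m p := not_lt.1 hmr
          have h4 := dist_triangle_left m p (dropCoord i P)
          rw [dropCoord_sub, ← hm, ← dist_eq_norm] at h1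
          gcongr
          linarith
      _ ≤ ((K + 1 : ℝ≥0) : ENNReal) ^ 2 *
            ∫⁻ _ in ball p (r / 2), ENNReal.ofReal (((r / 2) ^ 2)⁻¹) :=
          setLIntegral_comp_le_of_antilipschitz (dropCoordL i).continuous hD hSB measurable_const
      _ = B₂ := by rw [setLIntegral_const]

/-- The absolute solid angles of a bounded `C^{1,α}` boundary are bounded. -/
theorem exists_lintegral_solidAngleIntegrand_le {α : ℝ≥0} (hα : 0 < α) {Ω : Set E3}
    (hb : Bornology.IsBounded Ω) (hΩ : HasC1HolderBoundary α Ω) :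
    ∃ B < (⊤ : ENNReal), ∀ M : E3,
      ∫⁻ P, ENNReal.ofReal (solidAngleIntegrand Ω M P) ∂(surfaceMeasure Ω) ≤ B := by
  have hcomp : IsCompact (frontier Ω) :=
    isCompact_of_isClosed_isBounded isClosed_frontier (hb.closure.subset frontier_subset_closure)
  refine hcomp.induction_on (p := fun s => ∃ B < (⊤ : ENNReal), ∀ M : E3,
    ∫⁻ P in s, ENNReal.ofReal (solidAngleIntegrand Ω M P)
      ∂(Measure.euclideanHausdorffMeasure 2) ≤ B) ⟨0, by simp, by simp⟩ ?_ ?_ ?_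
  · rintro s t hst ⟨B, hB, h⟩
    exact ⟨B, hB, fun M => (lintegral_mono_set hst).trans (h M)⟩
  · rintro s t ⟨B, hB, h⟩ ⟨B', hB', h'⟩
    exact ⟨B + B', ENNReal.add_lt_top.2 ⟨hB, hB'⟩, fun M =>
      (lintegral_union_le _ _ _).trans (add_le_add (h M) (h' M))⟩
  · intro P₀ hP₀
    obtain ⟨s, hs, B, hB, h⟩ := exists_setLIntegral_solidAngleIntegrand_le hα hΩ hP₀
    exact ⟨_, inter_mem_nhdsWithin _ (ball_mem_nhds P₀ hs), B, hB, h⟩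

/-- The normal is defined by choice, so its measurability comes from its continuity on the closed
set `frontier Ω`. -/
theorem aestronglyMeasurable_solidAngleIntegrand {α : ℝ≥0} {Ω : Set E3}
    (hΩ : HasC1HolderBoundary α Ω) (M : E3) :
    AEStronglyMeasurable (fun P => solidAngleIntegrand Ω M P) (surfaceMeasure Ω) := by
  have hn : AEMeasurable (exteriorNormal Ω) (surfaceMeasure Ω) :=
    hΩ.continuousOn_exteriorNormal.aemeasurable isClosed_frontier.measurableSet
  have h1 : AEMeasurable (fun P : E3 => P - M) (surfaceMeasure Ω) := by fun_prop
  unfold solidAngleIntegrand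
  have h2 : AEMeasurable (fun P => |⟪P - M, exteriorNormal Ω P⟫|) (surfaceMeasure Ω) := by
    simpa only [Real.norm_eq_abs] using (h1.inner (𝕜 := ℝ) hn).norm
  exact (h2.div (h1.norm.pow_const 3)).aestronglyMeasurable

theorem theorem2p2 (Ω : Set E3) (hΩ_open : IsOpen Ω) (hΩ_conn : IsConnected Ω)
    (hΩ_bdd : Bornology.IsBounded Ω) (α : ℝ≥0) (hα_pos : 0 < α) (hα_le : α ≤ 1)
    (hΩ : HasC1HolderBoundary α Ω) :
    (∀ M : E3, Integrable (fun P => solidAngleIntegrand Ω M P) (surfaceMeasure Ω)) ∧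
    BddAbove (Set.range fun M : E3 => ∫ P, solidAngleIntegrand Ω M P ∂(surfaceMeasure Ω)) := by
  obtain ⟨B, hB, h⟩ := exists_lintegral_solidAngleIntegrand_le hα_pos hΩ_bdd hΩ
  have hm := aestronglyMeasurable_solidAngleIntegrand hΩ
  refine ⟨fun M => ⟨hm M, ?_⟩, B.toReal, ?_⟩
  · rw [hasFiniteIntegral_iff_ofReal (ae_of_all _ fun P => solidAngleIntegrand_nonneg Ω M P)]
    exact (h M).trans_lt hB
  · rintro _ ⟨M, rfl⟩
    beta_reduce
    rw [integral_eq_lintegral_of_nonneg_ae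
      (ae_of_all _ fun P => solidAngleIntegrand_nonneg Ω M P) (hm M)]
    exact ENNReal.toReal_mono hB.ne (h M)
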